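/- \textbf{Theorem (phase gap of the generalized Metropolis--Hastings walk operator).} Let $\Omega\subset\mathbb{R}^d$ be a finite set, let $P:\Omega\to(0,1)$ be a probability distribution on $\Omega$ and, for every $x\in\Omega$, let $T(x,\cdot):\Omega\to(0,1)$ be a probability distribution on $\Omega$. For $x,y\in\Omega$ put $$A(x,y)=\min\left\{1,\frac{P(y)T(y,x)}{P(x)T(x,y)}\right\},\qquad W_{x,y}=\begin{cases}T(x,y)A(x,y)& (x\ne y)\\ 1-\sum_{z\in\Omega\setminus\{x\}}T(x,z)A(x,z)& (x=y),\end{cases}$$ so that $W$ is the transition matrix of the Metropolis--Hastings chain. Let $\Delta=1-|\lambda_1|$ be its spectral gap, where $\lambda_1$ is the eigenvalue of $W$ of second largest modulus (eigenvalues counted with multiplicity). For $x\in\Omega$ let $\Delta\Omega_x=\{m\in\mathbb{R}^d : x+m\in\Omega\}$. Consider two registers $R_{\rm S},R_{\rm M}$, whose computational basis states are labelled by finite sets of vectors in $\mathbb{R}^d$ that contain $\Omega$ and $\bigcup_{x\in\Omega}\Delta\Omega_x$ respectively, and a qubit $R_{\rm C}$. Let $V$ (on $R_{\rm S},R_{\rm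 M}$), $S$ (on $R_{\rm M},R_{\rm C}$), and $B,F$ (on the whole system) be unitaries such that for all $x\in\Omega$ and $m\in\Delta\Omega_x$ $$V|x\rangle|0\rangle=\sum_{m'\in\Delta\Omega_x}\sqrt{T(x,x+m')}\,|x\rangle|m'\rangle,$$ $$B|x\rangle|m\rangle|\phi\rangle=|x\rangle|m\rangle\otimes\begin{pmatrix}\sqrt{1-a}&-\sqrt{a}\\ \sqrt{a}&\sqrt{1-a}\end{pmatrix}|\phi\rangle\quad\text{with } a=A(x,x+m),\ \text{for every state } |\phi\rangle \text{ of } R_{\rm C},$$ $$F|x\rangle|m\rangle|0\rangle=|x\rangle|m\rangle|0\rangle,\quad F|x\rangle|m\rangle|1\rangle=|x+m\rangle|m\rangle|1\rangle,\qquad S|m\rangle|0\rangle=|m\rangle|0\rangle,\quad S|m\rangle|1\rangle=|{-m}\rangle|1\rangle .$$ Their action on the remaining basis states is arbitrary, except that $V$ maps $\mathrm{span}\{|x\rangle|m\rangle : x\in\Omega,\ m \text{ any label of } R_{\rm M}\}$ into itself (which is automatic if $\Omega$ is the whole label set of $R_{\rm S}$, or if $V$ is controlled by $R_{\rm S}$).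 Let $R=2\,(I\otimes|0\rangle\langle0|\otimes|0\rangle\langle 0|)-I$ and $U=RV^\dagger B^\dagger SFBV$ (with $V$ and $S$ extended by the identity to the whole system). Let $$\mathcal{A}=\mathrm{span}\{|x\rangle|0\rangle|0\rangle : x\in\Omega\},\qquad \mathcal{B}=V^\dagger B^\dagger SFBV\mathcal{A},\qquad |P\rangle=\sum_{x\in\Omega}\sqrt{P(x)}\,|x\rangle|0\rangle|0\rangle .$$ Then $U$ maps $\mathcal{A}+\mathcal{B}$ into itself. On $\mathcal{A}+\mathcal{B}$, the vector $|P\rangle$ is, up to scalar multiples, the unique eigenvector of $U$ with eigenvalue $1$. Every other eigenvalue of $U$ on $\mathcal{A}+\mathcal{B}$ can be written as $e^{i\theta}$ with $\theta\in\mathbb{R}$, and every such $\theta$ satisfies $|\theta|\ge\arccos(1-\Delta)$. -/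

import Mathlib

open scoped Matrix Kronecker

noncomputable section

/-- The data of the Metropolis–Hastings algorithm on a finite state space `Ω ⊂ ℝ^d`:
a target distribution `P : Ω → (0,1)` and, for every `x ∈ Ω`, a proposal distribution
`T x : Ω → (0,1)`. Only the values of `P` and `T` at points of `Ω` matter. -/
structure MHChain (d : ℕ) where
  Ω : Finset (Fin d → ℝ)
  P : (Fin d → ℝ) → ℝ
  T : (Fin d → ℝ) → (Fin d → ℝ) → ℝ
  P_mem : ∀ x ∈ Ω, P x ∈ Set.Ioo (0 : ℝ) 1
  P_sum : ∑ x ∈ Ω, P x = 1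
  T_mem : ∀ x ∈ Ω, ∀ y ∈ Ω, T x y ∈ Set.Ioo (0 : ℝ) 1
  T_sum : ∀ x ∈ Ω, ∑ y ∈ Ω, T x y = 1

namespace MHChain

variable {d : ℕ} (C : MHChain d)

/-- The acceptance ratio `A(x,y)`. -/
def acc (x y : Fin d → ℝ) : ℝ :=
  min 1 (C.P y * C.T y x / (C.P x * C.T x y))

/-- The transition matrix `W` of the Markov chain; the row index is the current state. -/
def W : Matrix C.Ω C.Ω ℝ := Matrix.of fun x y =>
  if x = y then 1 - ∑ z ∈ C.Ω.erase x, C.T x z * C.acc x z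
  else C.T x y * C.acc x y

/-- The moduli of the complex eigenvalues of `W`, counted with algebraic multiplicity and
listed in decreasing order. -/
def eigenvalueModuli : List ℝ :=
  (((C.W.map (algebraMap ℝ ℂ)).charpoly.roots).map fun z => ‖z‖).sort (· ≥ ·)

/-- The spectral gap `Δ = 1 - |λ₁|`, with `λ₁` the eigenvalue of `W` of second largest modulus
(entry `1` of the list that starts with entry `0`; the list has at least two entries, because
`P x < 1` for all `x ∈ Ω` forces `Ω` to have at least two points). -/
def spectralGap : ℝ := 1 - C.eigenvalueModuli.getD 1 0

/-- The set `ΔΩ_x` of possible moves from `x`. -/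
def moves (x : Fin d → ℝ) : Finset (Fin d → ℝ) := C.Ω.image fun y => y - x

theorem mem_moves (x m : Fin d → ℝ) : m ∈ C.moves x ↔ x + m ∈ C.Ω := by
  simp only [moves, Finset.mem_image]
  constructor
  · rintro ⟨y, hy, rfl⟩
    simpa using hy
  · intro h
    exact ⟨x + m, h, by simp⟩

end MHChain

/-- The basis vector `|x⟩|m⟩` of two registers whose computational basis states are labelled by
the elements of `s` and `t`. -/
def ket₂ {d : ℕ} {s t : Finset (Fin d → ℝ)} (x m : Fin d → ℝ) : s × t → ℂ :=
  fun i => if (i.1 : Fin d → ℝ) = x ∧ (i.2 : Fin d → ℝ) = m then 1 else 0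

/-- The basis vector `|m⟩|c⟩` of a register and a qubit. -/
def ketQ {d : ℕ} {t : Finset (Fin d → ℝ)} (m : Fin d → ℝ) (c : Fin 2) : t × Fin 2 → ℂ :=
  fun i => if (i.1 : Fin d → ℝ) = m ∧ i.2 = c then 1 else 0

/-- The basis vector `|x⟩|m⟩|c⟩` of two registers and a qubit. -/
def ket₃ {d : ℕ} {s t : Finset (Fin d → ℝ)} (x m : Fin d → ℝ) (c : Fin 2) :
    s × t × Fin 2 → ℂ :=
  fun i => if (i.1 : Fin d → ℝ) = x ∧ (i.2.1 : Fin d → ℝ) = m ∧ i.2.2 = c then 1 else 0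

/-- An implementation of the building blocks of the quantum walk operator of a
Metropolis–Hastings chain. The registers `R_S` and `R_M` have computational basis states that
represent the vectors in the finite sets `SReg` and `MReg`; the former contains all states, the
latter all possible moves. The operators are any unitaries with the prescribed action on the basis
states that represent a state `x ∈ Ω` and a possible move from `x`; how they continue to the
remaining basis states is left free, except that `V` must not lead from a basis state with
`x ∈ Ω` on `R_S` to one with a non-state on `R_S` (an empty condition if `SReg = Ω`, and
satisfied if `V` is controlled by `R_S`). -/
structure WalkCircuit {d : ℕ} (C : MHChain d) where
  SReg : Finset (Fin d → ℝ)
  MReg : Finset (Fin d → ℝ)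
  states_subset : C.Ω ⊆ SReg
  moves_subset : ∀ x ∈ C.Ω, C.moves x ⊆ MReg
  /-- `V` acts on `R_S` and `R_M`. -/
  V : Matrix.unitaryGroup (SReg × MReg) ℂ
  V_apply : ∀ x ∈ C.Ω, (V : Matrix (SReg × MReg) (SReg × MReg) ℂ) *ᵥ ket₂ x 0 =
    ∑ m ∈ C.moves x, ((√(C.T x (x + m)) : ℝ) : ℂ) • ket₂ x m
  V_states : ∀ i j : SReg × MReg, (j.1 : Fin d → ℝ) ∈ C.Ω → (i.1 : Fin d → ℝ) ∉ C.Ω →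
    (V : Matrix (SReg × MReg) (SReg × MReg) ℂ) i j = 0
  /-- `B` rotates the qubit `R_C` under the control of `R_S` and `R_M`. -/
  B : Matrix.unitaryGroup (SReg × MReg × Fin 2) ℂ
  B_apply_zero : ∀ x ∈ C.Ω, ∀ m ∈ C.moves x,
    (B : Matrix (SReg × MReg × Fin 2) (SReg × MReg × Fin 2) ℂ) *ᵥ ket₃ x m 0 =
      ((√(1 - C.acc x (x + m)) : ℝ) : ℂ) • ket₃ x m 0 +
      ((√(C.acc x (x + m)) : ℝ) : ℂ) • ket₃ x m 1
  B_apply_one : ∀ x ∈ C.Ω, ∀ m ∈ C.moves x,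
    (B : Matrix (SReg × MReg × Fin 2) (SReg × MReg × Fin 2) ℂ) *ᵥ ket₃ x m 1 =
      (-((√(C.acc x (x + m)) : ℝ) : ℂ)) • ket₃ x m 0 +
      ((√(1 - C.acc x (x + m)) : ℝ) : ℂ) • ket₃ x m 1
  /-- `F` adds the move to the state under the control of `R_C`. -/
  F : Matrix.unitaryGroup (SReg × MReg × Fin 2) ℂ
  F_apply_zero : ∀ x ∈ C.Ω, ∀ m ∈ C.moves x,
    (F : Matrix (SReg × MReg × Fin 2) (SReg × MReg × Fin 2) ℂ) *ᵥ ket₃ x m 0 = ket₃ x m 0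
  F_apply_one : ∀ x ∈ C.Ω, ∀ m ∈ C.moves x,
    (F : Matrix (SReg × MReg × Fin 2) (SReg × MReg × Fin 2) ℂ) *ᵥ ket₃ x m 1 =
      ket₃ (x + m) m 1
  /-- `S` acts on `R_M` and `R_C`; it flips the sign of the move under the control of `R_C`. -/
  S : Matrix.unitaryGroup (MReg × Fin 2) ℂ
  S_apply_zero : ∀ x ∈ C.Ω, ∀ m ∈ C.moves x,
    (S : Matrix (MReg × Fin 2) (MReg × Fin 2) ℂ) *ᵥ ketQ m 0 = ketQ m 0
  S_apply_one : ∀ x ∈ C.Ω, ∀ m ∈ C.moves x,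
    (S : Matrix (MReg × Fin 2) (MReg × Fin 2) ℂ) *ᵥ ketQ m 1 = ketQ (-m) 1

namespace WalkCircuit

variable {d : ℕ} {C : MHChain d} (Q : WalkCircuit C)

/-- The computational basis of the whole system `R_S`, `R_M`, `R_C`. -/
abbrev Idx : Type := Q.SReg × Q.MReg × Fin 2

/-- `V ⊗ I` on the whole system. -/
def opV : Matrix Q.Idx Q.Idx ℂ :=
  Matrix.reindex (Equiv.prodAssoc _ _ _) (Equiv.prodAssoc _ _ _)
    ((Q.V : Matrix (Q.SReg × Q.MReg) (Q.SReg × Q.MReg) ℂ) ⊗ₖ (1 : Matrix (Fin 2) (Fin 2) ℂ))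

/-- `I ⊗ S` on the whole system. -/
def opS : Matrix Q.Idx Q.Idx ℂ :=
  (1 : Matrix Q.SReg Q.SReg ℂ) ⊗ₖ (Q.S : Matrix (Q.MReg × Fin 2) (Q.MReg × Fin 2) ℂ)

def opB : Matrix Q.Idx Q.Idx ℂ := (Q.B : Matrix _ _ ℂ)

def opF : Matrix Q.Idx Q.Idx ℂ := (Q.F : Matrix _ _ ℂ)

/-- The projection `Λ₀ = I ⊗ |0⟩⟨0| ⊗ |0⟩⟨0|`. -/
def proj₀ : Matrix Q.Idx Q.Idx ℂ :=
  Matrix.diagonal fun i => if (i.2.1 : Fin d → ℝ) = 0 ∧ i.2.2 = 0 then 1 else 0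

/-- The reflection `R = 2Λ₀ - I`. -/
def opR : Matrix Q.Idx Q.Idx ℂ := (2 : ℂ) • Q.proj₀ - 1

/-- `V† B† S F B V`. -/
def core : Matrix Q.Idx Q.Idx ℂ :=
  Q.opVᴴ * Q.opBᴴ * Q.opS * Q.opF * Q.opB * Q.opV

/-- The walk operator `U = R V† B† S F B V`. -/
def U : Matrix Q.Idx Q.Idx ℂ := Q.opR * Q.core

/-- `𝒜 = span {|x⟩|0⟩|0⟩ : x ∈ Ω}`. -/
def spaceA : Submodule ℂ (Q.Idx → ℂ) :=
  Submodule.span ℂ {v | ∃ x ∈ C.Ω, v = ket₃ x 0 0}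

/-- `ℬ = V† B† S F B V 𝒜`. -/
def spaceB : Submodule ℂ (Q.Idx → ℂ) := Q.spaceA.map Q.core.mulVecLin

/-- `|P⟩ = ∑ x, √P(x) |x⟩|0⟩|0⟩`. -/
def ketP : Q.Idx → ℂ := ∑ x ∈ C.Ω, ((√(C.P x) : ℝ) : ℂ) • ket₃ x 0 0

end WalkCircuit

end

/-! ### Products of two reflections -/

section UnitaryReflection

variable {n : Type*} [Fintype n]

/-! Write `G` for `V† B† S F B V`, `L` for the projection `Λ₀`, and `A` for `𝒜`, so that `U = (2L -
1)G` acts on `A + GA`. The proof is Szegedy's spectral argument for a product of two reflections.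
`G` is unitary everywhere but is shown to be an involution only on `A + GA`, and this suffices.

Three facts about the circuit are needed. First, `G² = 1` on `A`, because `SF` sends `|x⟩|m⟩|1⟩` to
`|x+m⟩|-m⟩|1⟩` and fixes `|x⟩|m⟩|0⟩`, hence is an involution on the legal moves
(`core_mulVec_core_mulVec`). Second, `L` maps `GA` into `A`, because `G` does not lead from `A` to
labels outside `Ω` (`core_mulVec_mem_stateSpace`). Third, by detailed balance `LG` restricted to `A`
has matrix `√P(y) W(y,x) / √P(x)` and is thus similar to `W` (`core_mulVec_ket_apply`).

If `Uv = zv` and `p = Lv`, then `(1 - z²)v = 2z Gp - 2z² p`. For `z = e^{iθ} ≠ ±1` this gives `p ≠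
0` and, after applying `L`, `LGp = cos θ · p`. So `cos θ ≠ 1` is an eigenvalue of `W`, whence `|cos
θ| ≤ 1 - Δ`. For `z = -1` already `|θ| ≥ π`. For `z = 1` one finds that `v` lies in `A` and is fixed
by `LG`; it then corresponds to a harmonic function of the chain, which is constant by the maximum
principle, so `v` is a multiple of `|P⟩`. -/

open scoped ComplexOrder in
theorem star_dotProduct_self_eq_zero {v : n → ℂ} : star v ⬝ᵥ v = 0 ↔ v = 0 :=
  dotProduct_star_self_eq_zero

theorem star_mulVec_dotProduct (M : Matrix n n ℂ) (v w : n → ℂ) :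
    star (M *ᵥ v) ⬝ᵥ w = star v ⬝ᵥ (Mᴴ *ᵥ w) := by
  rw [Matrix.star_mulVec, Matrix.dotProduct_mulVec]

variable {G L : Matrix n n ℂ} {A : Submodule ℂ (n → ℂ)}

/-- Every vector of `A + G A` has the form `a + G b`. -/
theorem exists_add_mulVec_of_mem_sup {v : n → ℂ} (hv : v ∈ A ⊔ A.map G.mulVecLin) :
    ∃ a ∈ A, ∃ b ∈ A, v = a + G *ᵥ b := by
  obtain ⟨a, ha, c, hc, rfl⟩ := Submodule.mem_sup.mp hv
  obtain ⟨b, hb, rfl⟩ := Submodule.mem_map.mp hc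
  exact ⟨a, ha, b, hb, rfl⟩

theorem mulVec_mulVec_of_mem_sup (hGG : ∀ a ∈ A, G *ᵥ (G *ᵥ a) = a) {v : n → ℂ}
    (hv : v ∈ A ⊔ A.map G.mulVecLin) : G *ᵥ (G *ᵥ v) = v := by
  obtain ⟨a, ha, b, hb, rfl⟩ := exists_add_mulVec_of_mem_sup hv
  rw [Matrix.mulVec_add, Matrix.mulVec_add, hGG a ha, hGG b hb]

theorem projection_mulVec_mem (hLA : ∀ a ∈ A, L *ᵥ a = a) (hLG : ∀ a ∈ A, L *ᵥ (G *ᵥ a) ∈ A)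
    {v : n → ℂ} (hv : v ∈ A ⊔ A.map G.mulVecLin) : L *ᵥ v ∈ A := by
  obtain ⟨a, ha, b, hb, rfl⟩ := exists_add_mulVec_of_mem_sup hv
  rw [Matrix.mulVec_add, hLA a ha]
  exact A.add_mem ha (hLG b hb)

variable [DecidableEq n]

theorem star_mulVec_dotProduct_mulVec {M : Matrix n n ℂ} (hM : Mᴴ * M = 1) (v w : n → ℂ) :
    star (M *ᵥ v) ⬝ᵥ (M *ᵥ w) = star v ⬝ᵥ w := by
  rw [star_mulVec_dotProduct, Matrix.mulVec_mulVec, hM, Matrix.one_mulVec]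

theorem norm_eq_one_of_mulVec_eq_smul {M : Matrix n n ℂ} (hM : Mᴴ * M = 1) {z : ℂ} {v : n → ℂ}
    (hv : v ≠ 0) (h : M *ᵥ v = z • v) : ‖z‖ = 1 := by
  have h1 := star_mulVec_dotProduct_mulVec hM v v
  have h2 : star v ⬝ᵥ v ≠ 0 := mt star_dotProduct_self_eq_zero.mp hv
  rw [h, star_smul, smul_dotProduct, dotProduct_smul, smul_smul, smul_eq_mul] at h1
  have h3 : star z * z = 1 := mul_right_cancel₀ h2 (by rw [h1, one_mul])
  have h4 : ‖z‖ * ‖z‖ = 1 := by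
    have := congrArg norm h3
    rwa [norm_mul, norm_star, norm_one] at this
  nlinarith [norm_nonneg z]

/-- In finite dimension an injective map of `E` into itself is onto, so the inverse `Mᴴ` preserves
`E` as well. This yields control of `V†` and `B†`, of which only the forward action is prescribed.
-/
theorem conjTranspose_mulVec_mem {M : Matrix n n ℂ} (hM : Mᴴ * M = 1) {E : Submodule ℂ (n → ℂ)}
    (hE : ∀ v ∈ E, M *ᵥ v ∈ E) {v : n → ℂ} (hv : v ∈ E) : Mᴴ *ᵥ v ∈ E := by
  have hinv (w : n → ℂ) : Mᴴ *ᵥ (M *ᵥ w) = w := by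
    rw [Matrix.mulVec_mulVec, hM, Matrix.one_mulVec]
  let f : E →ₗ[ℂ] E := M.mulVecLin.restrict hE
  have hf : Function.Injective f := by
    intro a b hab
    have h : M *ᵥ (a : n → ℂ) = M *ᵥ (b : n → ℂ) := congrArg Subtype.val hab
    exact Subtype.ext (by rw [← hinv a, h, hinv])
  obtain ⟨w, hw⟩ := LinearMap.injective_iff_surjective.mp hf ⟨v, hv⟩
  have h : M *ᵥ (w : n → ℂ) = v := congrArg Subtype.val hw
  rw [← h, hinv]
  exact w.2

theorem conjTranspose_mul_self_of_reflection (hG : Gᴴ * G = 1) (hL : Lᴴ = L) (hLL : L * L = L) :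
    (((2 : ℂ) • L - 1) * G)ᴴ * (((2 : ℂ) • L - 1) * G) = 1 := by
  have h : ((2 : ℂ) • L - 1)ᴴ * ((2 : ℂ) • L - 1) = 1 := by
    rw [Matrix.conjTranspose_sub, Matrix.conjTranspose_smul, hL, Matrix.conjTranspose_one]
    simp only [sub_mul, mul_sub, Matrix.smul_mul, Matrix.mul_smul, hLL, one_mul, mul_one,
      star_ofNat]
    module
  rw [Matrix.conjTranspose_mul, Matrix.mul_assoc, ← Matrix.mul_assoc _ _ G, h, Matrix.one_mul, hG]

theorem reflection_mul_mulVec (v : n → ℂ) :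
    (((2 : ℂ) • L - 1) * G) *ᵥ v = (2 : ℂ) • (L *ᵥ (G *ᵥ v)) - G *ᵥ v := by
  rw [← Matrix.mulVec_mulVec, Matrix.sub_mulVec, Matrix.smul_mulVec, Matrix.one_mulVec]

/-- `G` exchanges the two summands `A` and `GA`, and `L` sends both into `A`. -/
theorem reflection_mul_mulVec_mem_sup (hLA : ∀ a ∈ A, L *ᵥ a = a)
    (hLG : ∀ a ∈ A, L *ᵥ (G *ᵥ a) ∈ A) (hGG : ∀ a ∈ A, G *ᵥ (G *ᵥ a) = a)
    {v : n → ℂ} (hv : v ∈ A ⊔ A.map G.mulVecLin) :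
    (((2 : ℂ) • L - 1) * G) *ᵥ v ∈ A ⊔ A.map G.mulVecLin := by
  obtain ⟨a, ha, b, hb, rfl⟩ := exists_add_mulVec_of_mem_sup hv
  rw [reflection_mul_mulVec, Matrix.mulVec_add, Matrix.mulVec_add, hGG b hb, hLA b hb]
  have h : (2 : ℂ) • (L *ᵥ (G *ᵥ a) + b) - (G *ᵥ a + b) =
      ((2 : ℂ) • (L *ᵥ (G *ᵥ a)) + b) + G *ᵥ (-a) := by
    rw [Matrix.mulVec_neg]
    module
  rw [h]
  exact Submodule.add_mem_sup (A.add_mem (A.smul_mem _ (hLG a ha)) hb)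
    (Submodule.mem_map_of_mem (f := G.mulVecLin) (A.neg_mem ha))

/-- `2L - 1` is its own inverse and can be moved to the other side. -/
theorem mulVec_eq_of_reflection_eigenvector (hLL : L * L = L) {z : ℂ} {v : n → ℂ}
    (hz : (((2 : ℂ) • L - 1) * G) *ᵥ v = z • v) : G *ᵥ v = z • ((2 : ℂ) • (L *ᵥ v) - v) := by
  rw [reflection_mul_mulVec] at hz
  have h1 : L *ᵥ (G *ᵥ v) = z • (L *ᵥ v) := by
    have := congrArg (L *ᵥ ·) hz
    simp only [Matrix.mulVec_sub, Matrix.mulVec_smul] at this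
    rw [Matrix.mulVec_mulVec _ L L, hLL] at this
    rw [← this]
    module
  rw [h1] at hz
  linear_combination (norm := module) -hz

/-- Apply `G` to `Gv = z(2Lv - v)`, use `G²v = v` on the left, and substitute the same formula for
the remaining `Gv`. For `z² ≠ 1` this recovers `v` from its projection `Lv`. -/
theorem smul_eq_of_reflection_eigenvector (hLL : L * L = L)
    (hGG : ∀ a ∈ A, G *ᵥ (G *ᵥ a) = a) {z : ℂ} {v : n → ℂ} (hv : v ∈ A ⊔ A.map G.mulVecLin)
    (hz : (((2 : ℂ) • L - 1) * G) *ᵥ v = z • v) :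
    (1 - z ^ 2) • v = (2 * z) • (G *ᵥ (L *ᵥ v)) - (2 * z ^ 2) • (L *ᵥ v) := by
  have h1 := mulVec_eq_of_reflection_eigenvector hLL hz
  have h2 := mulVec_mulVec_of_mem_sup hGG hv
  rw [h1, Matrix.mulVec_smul, Matrix.mulVec_sub, Matrix.mulVec_smul, h1] at h2
  linear_combination (norm := module) -h2

/-- An eigenvector of the product of two reflections with eigenvalue `z ≠ ±1` yields an eigenvector
of the compression of `G` to `A`. -/
theorem exists_compression_eigenvector (hLA : ∀ a ∈ A, L *ᵥ a = a) (hLL : L * L = L)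
    (hLG : ∀ a ∈ A, L *ᵥ (G *ᵥ a) ∈ A) (hGG : ∀ a ∈ A, G *ᵥ (G *ᵥ a) = a)
    {z : ℂ} (hz2 : z ^ 2 ≠ 1) {v : n → ℂ} (hv : v ∈ A ⊔ A.map G.mulVecLin) (hv0 : v ≠ 0)
    (hz : (((2 : ℂ) • L - 1) * G) *ᵥ v = z • v) :
    ∃ p ∈ A, p ≠ 0 ∧ (2 * z) • (L *ᵥ (G *ᵥ p)) = (1 + z ^ 2) • p := by
  have h := smul_eq_of_reflection_eigenvector hLL hGG hv hz
  refine ⟨L *ᵥ v, projection_mulVec_mem hLA hLG hv, ?_, ?_⟩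
  · intro h0
    rw [h0, Matrix.mulVec_zero, smul_zero, smul_zero, sub_zero] at h
    exact (smul_ne_zero (sub_ne_zero.mpr hz2.symm) hv0) h
  · have h' := congrArg (L *ᵥ ·) h
    simp only [Matrix.mulVec_sub, Matrix.mulVec_smul] at h'
    rw [Matrix.mulVec_mulVec _ L L, hLL] at h'
    linear_combination (norm := module) -h'

/-- `Lw = 0` makes `w` orthogonal to `A`; since also `Gᴴw = -w`, it is orthogonal to `GA`, hence to
itself. -/
theorem eq_zero_of_projection_eq_zero_of_mulVec_eq_neg (hG : Gᴴ * G = 1) (hL : Lᴴ = L)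
    (hLA : ∀ a ∈ A, L *ᵥ a = a) {w : n → ℂ} (hw : w ∈ A ⊔ A.map G.mulVecLin)
    (hLw : L *ᵥ w = 0) (hGw : G *ᵥ w = -w) : w = 0 := by
  have hA (a : n → ℂ) (ha : a ∈ A) : star a ⬝ᵥ w = 0 := by
    rw [← hLA a ha, star_mulVec_dotProduct, hL, hLw, dotProduct_zero]
  have hw' : Gᴴ *ᵥ w = -w := by
    have : Gᴴ *ᵥ (G *ᵥ w) = w := by rw [Matrix.mulVec_mulVec, hG, Matrix.one_mulVec]
    rw [hGw, Matrix.mulVec_neg] at this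
    rw [← neg_eq_iff_eq_neg, this]
  have h0 : star w ⬝ᵥ w = 0 := by
    obtain ⟨a, ha, b, hb, hab⟩ := exists_add_mulVec_of_mem_sup hw
    nth_rw 1 [hab]
    rw [star_add, add_dotProduct, hA a ha, star_mulVec_dotProduct, hw', dotProduct_neg, hA b hb,
      neg_zero, add_zero]
  exact star_dotProduct_self_eq_zero.mp h0

/-- A fixed vector of the product of two reflections on `A + G A` lies in `A` and is fixed by the
compression of `G` to `A`. -/
theorem mem_and_compression_fixed (hG : Gᴴ * G = 1) (hL : Lᴴ = L)
    (hLA : ∀ a ∈ A, L *ᵥ a = a) (hLL : L * L = L) (hLG : ∀ a ∈ A, L *ᵥ (G *ᵥ a) ∈ A)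
    (hGG : ∀ a ∈ A, G *ᵥ (G *ᵥ a) = a) {v : n → ℂ} (hv : v ∈ A ⊔ A.map G.mulVecLin)
    (h1 : (((2 : ℂ) • L - 1) * G) *ᵥ v = v) : v ∈ A ∧ L *ᵥ (G *ᵥ v) = v := by
  have hz : (((2 : ℂ) • L - 1) * G) *ᵥ v = (1 : ℂ) • v := by rw [h1, one_smul]
  have hp := projection_mulVec_mem hLA hLG hv
  -- At `z = 1` the coefficient of `v` vanishes and the identity reads `0 = 2 G(Lv) - 2 Lv`. It says
  -- nothing about `v - Lv`, which is shown to be zero separately.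
  have hGp : G *ᵥ (L *ᵥ v) = L *ᵥ v := by
    have h := smul_eq_of_reflection_eigenvector hLL hGG hv hz
    linear_combination (norm := module) (-1 / 2 : ℂ) • h
  have hGv := mulVec_eq_of_reflection_eigenvector hLL hz
  have hw : v - L *ᵥ v = 0 := by
    refine eq_zero_of_projection_eq_zero_of_mulVec_eq_neg hG hL hLA
      (Submodule.sub_mem _ hv (Submodule.mem_sup_left hp)) ?_ ?_
    · rw [Matrix.mulVec_sub, Matrix.mulVec_mulVec, hLL, sub_self]
    · rw [Matrix.mulVec_sub, hGp, hGv]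
      module
  have hv' : L *ᵥ v = v := (sub_eq_zero.mp hw).symm
  rw [hv'] at hGp hp
  exact ⟨hp, by rw [hGp, hv']⟩

/-- This is the equality case of Cauchy–Schwarz: `⟨p, Gp⟩ = ⟨p, p⟩` and `G` is isometric, so `‖Gp -
p‖² = 0`. -/
theorem reflection_fixed_of_compression_fixed (hG : Gᴴ * G = 1) (hL : Lᴴ = L)
    (hLA : ∀ a ∈ A, L *ᵥ a = a) {p : n → ℂ} (hp : p ∈ A) (h : L *ᵥ (G *ᵥ p) = p) :
    (((2 : ℂ) • L - 1) * G) *ᵥ p = p := by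
  have h1 : star p ⬝ᵥ (G *ᵥ p) = star p ⬝ᵥ p := by
    nth_rw 1 [← hLA p hp]
    rw [star_mulVec_dotProduct, hL, h]
  have h2 : star (G *ᵥ p) ⬝ᵥ p = star p ⬝ᵥ p := by
    have := congrArg star h1
    rwa [← Matrix.star_dotProduct, ← Matrix.star_dotProduct] at this
  have h3 : star (G *ᵥ p - p) ⬝ᵥ (G *ᵥ p - p) = 0 := by
    rw [star_sub, sub_dotProduct, dotProduct_sub, dotProduct_sub,
      star_mulVec_dotProduct_mulVec hG, h1, h2]
    ring
  have h4 : G *ᵥ p = p := sub_eq_zero.mp (star_dotProduct_self_eq_zero.mp h3)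
  rw [reflection_mul_mulVec, h, h4]
  module

end UnitaryReflection

/-! ### Second largest entry, characteristic roots and arccosine -/

/-- Counted with multiplicity, at most one of `a`, `b` is used up by the head of the list, so the
other is bounded by the next entry. The default value `0` plays no role, since the list has at least
two entries. -/
theorem min_le_getD_one_of_pairwise {l : List ℝ} (hl : l.Pairwise (· ≥ ·)) {a b : ℝ}
    (h : ({a, b} : Multiset ℝ) ≤ (l : Multiset ℝ)) : min a b ≤ l.getD 1 0 := by
  have hcard := Multiset.card_le_card h
  match l, hl, h, hcard with
  | [], _, _, hc => simp at hc
  | [c], _, _, hc => simp at hc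
  | c :: e :: t, hl, h, _ =>
    have hle : ∀ x ∈ e :: t, x ≤ e := by
      intro x hx
      rcases List.mem_cons.mp hx with rfl | hx
      · exact le_rfl
      · exact (List.pairwise_cons.mp (List.pairwise_cons.mp hl).2).1 x hx
    rw [← Multiset.cons_coe, Multiset.insert_eq_cons] at h
    change min a b ≤ e
    by_cases hac : a = c
    · subst hac
      have hb := (Multiset.cons_le_cons_iff a).mp h
      exact (min_le_right _ _).trans (hle b (by simpa using hb))
    · have ha := Multiset.mem_of_le h (Multiset.mem_cons_self a {b})
      exact (min_le_left _ _).trans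
        (hle a (by simpa using (Multiset.mem_cons.mp ha).resolve_left hac))

theorem Matrix.mem_charpoly_roots_of_mulVec {n : Type*} [Fintype n] [DecidableEq n]
    {M : Matrix n n ℂ} {v : n → ℂ} (hv : v ≠ 0) {z : ℂ} (h : M *ᵥ v = z • v) :
    z ∈ M.charpoly.roots := by
  rw [Polynomial.mem_roots (Matrix.charpoly_monic M).ne_zero, Polynomial.IsRoot,
    Matrix.eval_charpoly]
  refine Matrix.exists_mulVec_eq_zero_iff.mp ⟨v, hv, ?_⟩
  rw [Matrix.sub_mulVec, h, Matrix.scalar_apply, ← Matrix.smul_one_eq_diagonal,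
    Matrix.smul_mulVec, Matrix.one_mulVec, sub_self]

/-- `θ` is not reduced modulo `2π`; for `|θ| ≥ π` the bound holds because `arccos ≤ π`. -/
theorem Real.arccos_le_abs_of_cos_le {θ c : ℝ} (h : Real.cos θ ≤ c) : Real.arccos c ≤ |θ| := by
  rcases le_total |θ| Real.pi with hθ | hθ
  · rw [← Real.cos_abs] at h
    calc Real.arccos c ≤ Real.arccos (Real.cos |θ|) := Real.antitone_arccos h
      _ = |θ| := Real.arccos_cos (abs_nonneg θ) hθ
  · exact (Real.arccos_le_pi c).trans hθ

/-! ### The Metropolis–Hastings chain and its spectrum -/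

namespace MHChain

variable {d : ℕ} (C : MHChain d)

theorem acc_pos {x y : Fin d → ℝ} (hx : x ∈ C.Ω) (hy : y ∈ C.Ω) : 0 < C.acc x y := by
  have h1 := (C.P_mem x hx).1
  have h2 := (C.P_mem y hy).1
  have h3 := (C.T_mem x hx y hy).1
  have h4 := (C.T_mem y hy x hx).1
  exact lt_min zero_lt_one (by positivity)

theorem acc_le_one (x y : Fin d → ℝ) : C.acc x y ≤ 1 := min_le_left _ _

/-- Both sides equal `min (P x T(x,y)) (P y T(y,x))`. -/
theorem detailed_balance {x y : Fin d → ℝ} (hx : x ∈ C.Ω) (hy : y ∈ C.Ω) :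
    C.P x * (C.T x y * C.acc x y) = C.P y * (C.T y x * C.acc y x) := by
  have h1 := (C.P_mem x hx).1
  have h2 := (C.P_mem y hy).1
  have h3 := (C.T_mem x hx y hy).1
  have h4 := (C.T_mem y hy x hx).1
  have e1 : C.P x * (C.T x y * C.acc x y) = min (C.P x * C.T x y) (C.P y * C.T y x) := by
    rw [acc, ← mul_assoc, mul_min_of_nonneg _ _ (by positivity), mul_one,
      mul_div_cancel₀ _ (by positivity)]
  have e2 : C.P y * (C.T y x * C.acc y x) = min (C.P y * C.T y x) (C.P x * C.T x y) := by
    rw [acc, ← mul_assoc, mul_min_of_nonneg _ _ (by positivity), mul_one,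
      mul_div_cancel₀ _ (by positivity)]
  rw [e1, e2, min_comm]

theorem W_self (x : C.Ω) : C.W x x = 1 - ∑ z ∈ C.Ω.erase x, C.T x z * C.acc x z := by
  simp [W]

theorem W_of_ne {x y : C.Ω} (h : x ≠ y) : C.W x y = C.T x y * C.acc x y := by
  simp [W, h]

/-- Since `T x` sums to `1`, the holding probability splits into rejected proposals and the accepted
zero move. These are the contributions of the two qubit values in the circuit. -/
theorem W_self_eq (x : C.Ω) :
    C.W x x = (∑ z ∈ C.Ω, C.T x z * (1 - C.acc x z)) + C.T x x * C.acc x x := by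
  rw [W_self]
  have h := Finset.sum_erase_add C.Ω (fun z => C.T x z * C.acc x z) x.2
  have h2 := C.T_sum x x.2
  simp only [mul_sub, mul_one, Finset.sum_sub_distrib, h2]
  linarith

theorem W_row_sum (x : C.Ω) : ∑ y, C.W x y = 1 := by
  rw [← Finset.sum_erase_add _ _ (Finset.mem_univ x), W_self,
    Finset.sum_congr rfl fun y hy => C.W_of_ne (Finset.ne_of_mem_erase hy).symm]
  have e1 := Finset.sum_erase_add C.Ω (fun z => C.T x z * C.acc x z) x.2
  have e2 := Finset.sum_erase_add Finset.univ
    (fun z : C.Ω => C.T x z * C.acc x z) (Finset.mem_univ x)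
  have e3 := Finset.sum_coe_sort C.Ω (fun z => C.T x z * C.acc x z)
  linarith

theorem W_pos_of_ne {x y : C.Ω} (h : x ≠ y) : 0 < C.W x y := by
  rw [W_of_ne C h]
  exact mul_pos (C.T_mem x x.2 y y.2).1 (C.acc_pos x.2 y.2)

theorem nonempty : C.Ω.Nonempty := by
  by_contra h
  have := C.P_sum
  simp [Finset.not_nonempty_iff_eq_empty.mp h] at this

/-- Real harmonic functions of the chain are constant. -/
theorem harmonic_const {h : C.Ω → ℝ} (hh : ∀ x, ∑ y, C.W x y * h y = h x) (x y : C.Ω) :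
    h x = h y := by
  have : Nonempty C.Ω := C.nonempty.to_subtype
  obtain ⟨x₀, hx₀⟩ := Finite.exists_max h
  suffices H : ∀ z, h z = h x₀ by rw [H x, H y]
  -- Maximum principle: at a maximum `x₀` all terms are nonnegative, the diagonal one being zero
  -- whatever `W x₀ x₀` is, and the off-diagonal weights are positive.
  have hs : ∑ y, C.W x₀ y * (h x₀ - h y) = 0 := by
    simp only [mul_sub, Finset.sum_sub_distrib, hh, ← Finset.sum_mul, W_row_sum, one_mul, sub_self]
  have hn : ∀ y ∈ Finset.univ, 0 ≤ C.W x₀ y * (h x₀ - h y) := by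
    intro y _
    by_cases hy : x₀ = y
    · simp [hy]
    · exact mul_nonneg (C.W_pos_of_ne hy).le (sub_nonneg.mpr (hx₀ y))
  intro z
  by_cases hz : x₀ = z
  · rw [hz]
  · have := (Finset.sum_eq_zero_iff_of_nonneg hn).mp hs z (Finset.mem_univ z)
    rcases mul_eq_zero.mp this with h0 | h0
    · exact absurd h0 (C.W_pos_of_ne hz).ne'
    · linarith

theorem complex_harmonic_const {h : C.Ω → ℂ}
    (hh : C.W.map (algebraMap ℝ ℂ) *ᵥ h = h) (x y : C.Ω) : h x = h y := by
  have hx (x : C.Ω) : ∑ y, (C.W x y : ℂ) * h y = h x := congrFun hh x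
  refine Complex.ext (C.harmonic_const (h := fun x => (h x).re) ?_ x y)
    (C.harmonic_const (h := fun x => (h x).im) ?_ x y)
  · intro x
    simpa using congrArg Complex.re (hx x)
  · intro x
    simpa using congrArg Complex.im (hx x)

theorem W_mulVec_one : C.W.map (algebraMap ℝ ℂ) *ᵥ 1 = 1 := by
  ext x
  simpa [Matrix.mulVec, dotProduct] using congrArg (algebraMap ℝ ℂ) (C.W_row_sum x)

/-- `1` and `z` are distinct roots of the characteristic polynomial, so `1` and `‖z‖` occupy
separate places in the list of moduli, even if `‖z‖ = 1`. The second entry is then at least `min 1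
‖z‖ = ‖z‖`. -/
theorem norm_le_of_eigenvector {z : ℂ} (hz : ‖z‖ ≤ 1) (hz1 : z ≠ 1) {h : C.Ω → ℂ} (h0 : h ≠ 0)
    (hh : C.W.map (algebraMap ℝ ℂ) *ᵥ h = z • h) : ‖z‖ ≤ 1 - C.spectralGap := by
  have : Nonempty C.Ω := C.nonempty.to_subtype
  have m1 : (1 : ℂ) ∈ (C.W.map (algebraMap ℝ ℂ)).charpoly.roots :=
    Matrix.mem_charpoly_roots_of_mulVec one_ne_zero (by rw [C.W_mulVec_one, one_smul])
  have m2 := Matrix.mem_charpoly_roots_of_mulVec h0 hh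
  have hle : ({1, z} : Multiset ℂ) ≤ (C.W.map (algebraMap ℝ ℂ)).charpoly.roots := by
    rw [Multiset.le_iff_subset (by simpa using hz1.symm)]
    intro w hw
    rcases (by simpa using hw : w = 1 ∨ w = z) with rfl | rfl <;> assumption
  have hle' := Multiset.map_le_map (f := fun z : ℂ => ‖z‖) hle
  rw [Multiset.insert_eq_cons, Multiset.map_cons, Multiset.map_singleton, norm_one] at hle'
  have := min_le_getD_one_of_pairwise (l := C.eigenvalueModuli) (a := 1) (b := ‖z‖)
    (Multiset.pairwise_sort _ _) (by
      rw [eigenvalueModuli, Multiset.sort_eq]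
      exact hle')
  rw [min_eq_right hz] at this
  rw [spectralGap]
  linarith

end MHChain

/-! ### The circuit operators and their invariant subspaces -/

namespace WalkCircuit

variable {d : ℕ} {C : MHChain d} (Q : WalkCircuit C)

theorem opV_conjTranspose_mul_self : Q.opVᴴ * Q.opV = 1 := by
  have h := Matrix.mem_unitaryGroup_iff'.mp Q.V.2
  rw [Matrix.star_eq_conjTranspose] at h
  rw [opV, Matrix.conjTranspose_reindex, Matrix.reindex_apply, Matrix.reindex_apply,
    Matrix.submatrix_mul_equiv, Matrix.conjTranspose_kronecker, ← Matrix.mul_kronecker_mul, h,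
    Matrix.conjTranspose_one, Matrix.one_mul, Matrix.one_kronecker_one, Matrix.submatrix_one_equiv]

theorem opS_conjTranspose_mul_self : Q.opSᴴ * Q.opS = 1 := by
  have h := Matrix.mem_unitaryGroup_iff'.mp Q.S.2
  rw [Matrix.star_eq_conjTranspose] at h
  rw [opS, Matrix.conjTranspose_kronecker, ← Matrix.mul_kronecker_mul, h,
    Matrix.conjTranspose_one, Matrix.one_mul, Matrix.one_kronecker_one]

theorem opB_conjTranspose_mul_self : Q.opBᴴ * Q.opB = 1 :=
  Matrix.mem_unitaryGroup_iff'.mp Q.B.2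

theorem core_mem_unitaryGroup : Q.core ∈ Matrix.unitaryGroup Q.Idx ℂ := by
  have hV : Q.opV ∈ Matrix.unitaryGroup Q.Idx ℂ :=
    Matrix.mem_unitaryGroup_iff'.mpr Q.opV_conjTranspose_mul_self
  have hB : Q.opB ∈ Matrix.unitaryGroup Q.Idx ℂ := Q.B.2
  have hF : Q.opF ∈ Matrix.unitaryGroup Q.Idx ℂ := Q.F.2
  have hS : Q.opS ∈ Matrix.unitaryGroup Q.Idx ℂ :=
    Matrix.mem_unitaryGroup_iff'.mpr Q.opS_conjTranspose_mul_self
  exact mul_mem (mul_mem (mul_mem (mul_mem (mul_mem (Unitary.star_mem hV) (Unitary.star_mem hB)) hS)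
    hF) hB) hV

theorem core_conjTranspose_mul_self : Q.coreᴴ * Q.core = 1 :=
  Matrix.mem_unitaryGroup_iff'.mp Q.core_mem_unitaryGroup

theorem proj₀_conjTranspose : Q.proj₀ᴴ = Q.proj₀ := by
  rw [proj₀, Matrix.diagonal_conjTranspose]
  congr 1
  ext i
  by_cases h : (i.2.1 : Fin d → ℝ) = 0 ∧ i.2.2 = 0 <;> simp [h]

theorem proj₀_mul_self : Q.proj₀ * Q.proj₀ = Q.proj₀ := by
  rw [proj₀, Matrix.diagonal_mul_diagonal]
  congr 1
  ext i
  by_cases h : (i.2.1 : Fin d → ℝ) = 0 ∧ i.2.2 = 0 <;> simp [h]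

theorem proj₀_mulVec_apply (v : Q.Idx → ℂ) (i : Q.Idx) :
    (Q.proj₀ *ᵥ v) i = if (i.2.1 : Fin d → ℝ) = 0 ∧ i.2.2 = 0 then v i else 0 := by
  rw [proj₀, Matrix.mulVec_diagonal]
  split_ifs <;> simp

theorem opV_mulVec_tensor (u : Q.SReg × Q.MReg → ℂ) (w : Fin 2 → ℂ) :
    Q.opV *ᵥ (fun i => u (i.1, i.2.1) * w i.2.2) =
      fun i => ((Q.V : Matrix _ _ ℂ) *ᵥ u) (i.1, i.2.1) * w i.2.2 := by
  ext ⟨x, m, c⟩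
  simp [opV, Matrix.mulVec, dotProduct, Fintype.sum_prod_type, Matrix.one_apply, Finset.sum_mul,
    mul_assoc]

theorem opS_mulVec_tensor (u : Q.SReg → ℂ) (w : Q.MReg × Fin 2 → ℂ) :
    Q.opS *ᵥ (fun i => u i.1 * w i.2) =
      fun i => u i.1 * ((Q.S : Matrix _ _ ℂ) *ᵥ w) i.2 := by
  ext ⟨x, m⟩
  rw [opS, Matrix.mulVec, dotProduct, Fintype.sum_prod_type, Finset.sum_eq_single x]
  · simp [Matrix.mulVec, dotProduct, Finset.mul_sum]
    exact Finset.sum_congr rfl fun _ _ => by ring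
  · intro y _ hy
    simp [Matrix.one_apply_ne hy.symm]
  · simp

theorem ket₃_eq_ket₂_mul {s t : Finset (Fin d → ℝ)} (x m : Fin d → ℝ) (c : Fin 2) :
    (ket₃ x m c : s × t × Fin 2 → ℂ) =
      fun i => (ket₂ x m : s × t → ℂ) (i.1, i.2.1) * (if i.2.2 = c then 1 else 0) := by
  ext i
  simp only [ket₃, ket₂, ← and_assoc, ite_and, mul_ite, mul_one, mul_zero]
  split_ifs <;> rfl

theorem ket₃_eq_mul_ketQ {s t : Finset (Fin d → ℝ)} (x m : Fin d → ℝ) (c : Fin 2) :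
    (ket₃ x m c : s × t × Fin 2 → ℂ) =
      fun i => (if (i.1 : Fin d → ℝ) = x then 1 else 0) * (ketQ m c : t × Fin 2 → ℂ) i.2 := by
  ext i
  simp only [ket₃, ketQ, ite_and, ite_mul, one_mul, zero_mul]

theorem zero_mem_moves {x : Fin d → ℝ} (hx : x ∈ C.Ω) : (0 : Fin d → ℝ) ∈ C.moves x := by
  rw [C.mem_moves, add_zero]
  exact hx

theorem neg_mem_moves {x m : Fin d → ℝ} (hx : x ∈ C.Ω) : -m ∈ C.moves (x + m) := by
  rw [C.mem_moves, add_neg_cancel_right]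
  exact hx

theorem opV_mulVec_ket {x : Fin d → ℝ} (hx : x ∈ C.Ω) :
    Q.opV *ᵥ ket₃ x 0 0 = ∑ m ∈ C.moves x, ((√(C.T x (x + m)) : ℝ) : ℂ) • ket₃ x m 0 := by
  rw [ket₃_eq_ket₂_mul, Q.opV_mulVec_tensor (ket₂ x 0) (fun c => if c = 0 then 1 else 0),
    Q.V_apply x hx]
  ext i
  simp only [ket₃_eq_ket₂_mul x, Finset.sum_apply, Pi.smul_apply, smul_eq_mul, Finset.sum_mul,
    mul_assoc]

theorem opS_mulVec_ket_zero {x m : Fin d → ℝ} (y : Fin d → ℝ) (hx : x ∈ C.Ω)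
    (hm : m ∈ C.moves x) : Q.opS *ᵥ ket₃ y m 0 = ket₃ y m 0 := by
  rw [ket₃_eq_mul_ketQ, Q.opS_mulVec_tensor
    (fun z => if (z : Fin d → ℝ) = y then 1 else 0) (ketQ m 0), Q.S_apply_zero x hx m hm]

theorem opS_mulVec_ket_one {x m : Fin d → ℝ} (y : Fin d → ℝ) (hx : x ∈ C.Ω)
    (hm : m ∈ C.moves x) : Q.opS *ᵥ ket₃ y m 1 = ket₃ y (-m) 1 := by
  rw [ket₃_eq_mul_ketQ, ket₃_eq_mul_ketQ, Q.opS_mulVec_tensor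
    (fun z => if (z : Fin d → ℝ) = y then 1 else 0) (ketQ m 1), Q.S_apply_one x hx m hm]

theorem opS_opF_mulVec_ket_zero {x m : Fin d → ℝ} (hx : x ∈ C.Ω) (hm : m ∈ C.moves x) :
    Q.opS *ᵥ (Q.opF *ᵥ ket₃ x m 0) = ket₃ x m 0 := by
  rw [opF, Q.F_apply_zero x hx m hm, Q.opS_mulVec_ket_zero x hx hm]

theorem opS_opF_mulVec_ket_one {x m : Fin d → ℝ} (hx : x ∈ C.Ω) (hm : m ∈ C.moves x) :
    Q.opS *ᵥ (Q.opF *ᵥ ket₃ x m 1) = ket₃ (x + m) (-m) 1 := by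
  rw [opF, Q.F_apply_one x hx m hm, Q.opS_mulVec_ket_one _ hx hm]

/-- The span of the basis states that represent a state of the chain, a possible move from it and
any state of the qubit. -/
def moveSpace : Submodule ℂ (Q.Idx → ℂ) :=
  Submodule.span ℂ {v | ∃ x ∈ C.Ω, ∃ m ∈ C.moves x, ∃ c : Fin 2, v = ket₃ x m c}

theorem ket_mem_moveSpace {x m : Fin d → ℝ} (hx : x ∈ C.Ω) (hm : m ∈ C.moves x) (c : Fin 2) :
    ket₃ x m c ∈ Q.moveSpace :=
  Submodule.subset_span ⟨x, hx, m, hm, c, rfl⟩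

/-- The span of the basis states whose first label is a state of the chain. -/
def stateSpace : Submodule ℂ (Q.Idx → ℂ) where
  carrier := {v | ∀ i : Q.Idx, (i.1 : Fin d → ℝ) ∉ C.Ω → v i = 0}
  add_mem' := by
    intro v w hv hw i hi
    rw [Pi.add_apply, hv i hi, hw i hi, add_zero]
  zero_mem' := fun _ _ => rfl
  smul_mem' := by
    intro c v hv i hi
    rw [Pi.smul_apply, hv i hi, smul_zero]

theorem ket_mem_stateSpace {x : Fin d → ℝ} (hx : x ∈ C.Ω) (m : Fin d → ℝ) (c : Fin 2) :
    ket₃ x m c ∈ Q.stateSpace := by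
  intro i hi
  rw [ket₃, if_neg]
  rintro ⟨rfl, -⟩
  exact hi hx

theorem moveSpace_le_stateSpace : Q.moveSpace ≤ Q.stateSpace := by
  refine Submodule.span_le.mpr ?_
  rintro _ ⟨x, hx, m, -, c, rfl⟩
  exact Q.ket_mem_stateSpace hx m c

theorem mulVec_mem_of_mem_span {M : Matrix Q.Idx Q.Idx ℂ} {E : Submodule ℂ (Q.Idx → ℂ)}
    {s : Set (Q.Idx → ℂ)} (h : ∀ v ∈ s, M *ᵥ v ∈ E) {v : Q.Idx → ℂ}
    (hv : v ∈ Submodule.span ℂ s) : M *ᵥ v ∈ E :=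
  (Submodule.span_le (p := E.comap M.mulVecLin)).mpr h hv

theorem opB_mulVec_mem_moveSpace {v : Q.Idx → ℂ} (hv : v ∈ Q.moveSpace) :
    Q.opB *ᵥ v ∈ Q.moveSpace := by
  refine Q.mulVec_mem_of_mem_span ?_ hv
  rintro _ ⟨x, hx, m, hm, c, rfl⟩
  have h0 := Q.ket_mem_moveSpace hx hm 0
  have h1 := Q.ket_mem_moveSpace hx hm 1
  fin_cases c
  · change Q.opB *ᵥ ket₃ x m 0 ∈ _
    rw [opB, Q.B_apply_zero x hx m hm]
    exact add_mem (Submodule.smul_mem _ _ h0) (Submodule.smul_mem _ _ h1)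
  · change Q.opB *ᵥ ket₃ x m 1 ∈ _
    rw [opB, Q.B_apply_one x hx m hm]
    exact add_mem (Submodule.smul_mem _ _ h0) (Submodule.smul_mem _ _ h1)

/-- The condition `V_states` enters here. It is needed because the action of `V` on `|x⟩|m⟩` with `m
≠ 0` is otherwise unspecified. -/
theorem opV_mulVec_mem_stateSpace {v : Q.Idx → ℂ} (hv : v ∈ Q.stateSpace) :
    Q.opV *ᵥ v ∈ Q.stateSpace := by
  intro i hi
  refine Finset.sum_eq_zero fun j _ => ?_
  by_cases hj : (j.1 : Fin d → ℝ) ∈ C.Ω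
  · have h : Q.opV i j = 0 := by
      simp [opV, Q.V_states (i.1, i.2.1) (j.1, j.2.1) hj hi]
    simp [h]
  · simp [hv j hj]

theorem opS_opF_mulVec_mem_moveSpace {v : Q.Idx → ℂ} (hv : v ∈ Q.moveSpace) :
    Q.opS *ᵥ (Q.opF *ᵥ v) ∈ Q.moveSpace := by
  rw [Matrix.mulVec_mulVec]
  refine Q.mulVec_mem_of_mem_span ?_ hv
  rintro _ ⟨x, hx, m, hm, c, rfl⟩
  rw [← Matrix.mulVec_mulVec]
  fin_cases c
  · change Q.opS *ᵥ (Q.opF *ᵥ ket₃ x m 0) ∈ _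
    rw [Q.opS_opF_mulVec_ket_zero hx hm]
    exact Q.ket_mem_moveSpace hx hm 0
  · change Q.opS *ᵥ (Q.opF *ᵥ ket₃ x m 1) ∈ _
    rw [Q.opS_opF_mulVec_ket_one hx hm]
    exact Q.ket_mem_moveSpace ((C.mem_moves x m).mp hm) (neg_mem_moves hx) 1

/-- An accepted move `(x, m)` becomes its reversal `(x + m, -m)`, again a legal move, and reversing
twice returns to the start. -/
theorem opS_opF_mulVec_involutive {v : Q.Idx → ℂ} (hv : v ∈ Q.moveSpace) :
    Q.opS *ᵥ (Q.opF *ᵥ (Q.opS *ᵥ (Q.opF *ᵥ v))) = v := by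
  induction hv using Submodule.span_induction with
  | mem v hv =>
    obtain ⟨x, hx, m, hm, c, rfl⟩ := hv
    fin_cases c
    · change Q.opS *ᵥ (Q.opF *ᵥ (Q.opS *ᵥ (Q.opF *ᵥ ket₃ x m 0))) = ket₃ x m 0
      rw [Q.opS_opF_mulVec_ket_zero hx hm, Q.opS_opF_mulVec_ket_zero hx hm]
    · change Q.opS *ᵥ (Q.opF *ᵥ (Q.opS *ᵥ (Q.opF *ᵥ ket₃ x m 1))) = ket₃ x m 1
      rw [Q.opS_opF_mulVec_ket_one hx hm,
        Q.opS_opF_mulVec_ket_one ((C.mem_moves x m).mp hm) (neg_mem_moves hx),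
        add_neg_cancel_right, neg_neg]
  | zero => simp only [Matrix.mulVec_zero]
  | add v w _ _ hv hw => simp only [Matrix.mulVec_add, hv, hw]
  | smul c v _ hv => simp only [Matrix.mulVec_smul, hv]

theorem core_mulVec (v : Q.Idx → ℂ) :
    Q.core *ᵥ v = Q.opVᴴ *ᵥ (Q.opBᴴ *ᵥ (Q.opS *ᵥ (Q.opF *ᵥ (Q.opB *ᵥ (Q.opV *ᵥ v))))) := by
  simp only [core, Matrix.mulVec_mulVec, Matrix.mul_assoc]

theorem opV_mulVec_mem_moveSpace {v : Q.Idx → ℂ} (hv : v ∈ Q.spaceA) :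
    Q.opV *ᵥ v ∈ Q.moveSpace := by
  refine Q.mulVec_mem_of_mem_span ?_ hv
  rintro _ ⟨x, hx, rfl⟩
  rw [Q.opV_mulVec_ket hx]
  exact Submodule.sum_mem _ fun m hm => Submodule.smul_mem _ _ (Q.ket_mem_moveSpace hx hm 0)

/-- In the square the inner `B V V† B†` cancels, which leaves `(SF)²` acting on `BV𝒜`, a subspace of
`moveSpace`. -/
theorem core_mulVec_core_mulVec {v : Q.Idx → ℂ} (hv : v ∈ Q.spaceA) :
    Q.core *ᵥ (Q.core *ᵥ v) = v := by
  have hE := Q.opB_mulVec_mem_moveSpace (Q.opV_mulVec_mem_moveSpace hv)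
  have hV (w : Q.Idx → ℂ) : Q.opV *ᵥ (Q.opVᴴ *ᵥ w) = w := by
    rw [Matrix.mulVec_mulVec, mul_eq_one_comm.mp Q.opV_conjTranspose_mul_self, Matrix.one_mulVec]
  have hB (w : Q.Idx → ℂ) : Q.opB *ᵥ (Q.opBᴴ *ᵥ w) = w := by
    rw [Matrix.mulVec_mulVec, mul_eq_one_comm.mp Q.opB_conjTranspose_mul_self, Matrix.one_mulVec]
  rw [core_mulVec, core_mulVec, hV, hB, Q.opS_opF_mulVec_involutive hE, Matrix.mulVec_mulVec,
    Matrix.mulVec_mulVec, Matrix.mulVec_mulVec, Matrix.mul_assoc, Matrix.mul_assoc,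
    ← Matrix.mul_assoc Q.opBᴴ, Q.opB_conjTranspose_mul_self, Matrix.one_mul,
    Q.opV_conjTranspose_mul_self, Matrix.one_mulVec]

/-- `SF` and `B†` keep `BV𝒜` within `moveSpace`. The final `V†` need not do so, but it preserves the
larger `stateSpace`, which is enough for `Λ₀` to lead back to `𝒜`. -/
theorem core_mulVec_mem_stateSpace {v : Q.Idx → ℂ} (hv : v ∈ Q.spaceA) :
    Q.core *ᵥ v ∈ Q.stateSpace := by
  have hE := Q.opB_mulVec_mem_moveSpace (Q.opV_mulVec_mem_moveSpace hv)
  rw [core_mulVec]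
  refine conjTranspose_mulVec_mem Q.opV_conjTranspose_mul_self
    (fun _ => Q.opV_mulVec_mem_stateSpace) (Q.moveSpace_le_stateSpace ?_)
  exact conjTranspose_mulVec_mem Q.opB_conjTranspose_mul_self
    (fun _ => Q.opB_mulVec_mem_moveSpace) (Q.opS_opF_mulVec_mem_moveSpace hE)

/-- The index of the basis state `|x⟩|0⟩|0⟩`. -/
def stateIdx (x : C.Ω) : Q.Idx :=
  (⟨x, Q.states_subset x.2⟩, ⟨0, Q.moves_subset x x.2 (zero_mem_moves x.2)⟩, 0)

theorem ket_apply_stateIdx (x y : C.Ω) :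
    (ket₃ x 0 0 : Q.Idx → ℂ) (Q.stateIdx y) = if x = y then 1 else 0 := by
  by_cases h : x = y
  · rw [if_pos h, ket₃, if_pos ⟨congrArg Subtype.val h.symm, rfl, rfl⟩]
  · rw [if_neg h, ket₃, if_neg fun h' => h (Subtype.ext h'.1.symm)]

theorem eq_sum_ket {v : Q.Idx → ℂ} (hv : v ∈ Q.stateSpace) (h0 : Q.proj₀ *ᵥ v = v) :
    v = ∑ x : C.Ω, v (Q.stateIdx x) • ket₃ x 0 0 := by
  ext i
  rw [Finset.sum_apply]
  simp only [Pi.smul_apply, smul_eq_mul]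
  have hi : v i = if (i.2.1 : Fin d → ℝ) = 0 ∧ i.2.2 = 0 then v i else 0 := by
    rw [← Q.proj₀_mulVec_apply, h0]
  by_cases h : (i.2.1 : Fin d → ℝ) = 0 ∧ i.2.2 = 0
  · by_cases hx : (i.1 : Fin d → ℝ) ∈ C.Ω
    · have hix : i = Q.stateIdx ⟨i.1, hx⟩ :=
        Prod.ext (Subtype.ext rfl) (Prod.ext (Subtype.ext h.1) h.2)
      rw [Finset.sum_eq_single ⟨(i.1 : Fin d → ℝ), hx⟩, ← hix]
      · simp [ket₃, h]
      · intro y _ hy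
        rw [ket₃, if_neg, mul_zero]
        rintro ⟨h', -⟩
        exact hy (Subtype.ext h'.symm)
      · simp
    · rw [hv i hx, Finset.sum_eq_zero]
      intro y _
      rw [ket₃, if_neg, mul_zero]
      rintro ⟨h', -⟩
      exact hx (h' ▸ y.2)
  · rw [hi, if_neg h, Finset.sum_eq_zero]
    intro y _
    rw [ket₃, if_neg (fun h' => h h'.2), mul_zero]

theorem ket_mem_spaceA {x : Fin d → ℝ} (hx : x ∈ C.Ω) : ket₃ x 0 0 ∈ Q.spaceA :=
  Submodule.subset_span ⟨x, hx, rfl⟩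

theorem mem_spaceA_of_proj₀ {v : Q.Idx → ℂ} (hv : v ∈ Q.stateSpace) (h0 : Q.proj₀ *ᵥ v = v) :
    v ∈ Q.spaceA := by
  rw [Q.eq_sum_ket hv h0]
  exact Submodule.sum_mem _ fun x _ => Submodule.smul_mem _ _ (Q.ket_mem_spaceA x.2)

theorem proj₀_mulVec_mem_spaceA {v : Q.Idx → ℂ} (hv : v ∈ Q.stateSpace) :
    Q.proj₀ *ᵥ v ∈ Q.spaceA := by
  refine Q.mem_spaceA_of_proj₀ ?_ ?_
  · intro i hi
    rw [Q.proj₀_mulVec_apply, hv i hi, ite_self]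
  · rw [Matrix.mulVec_mulVec, Q.proj₀_mul_self]

theorem proj₀_mulVec_of_mem_spaceA {v : Q.Idx → ℂ} (hv : v ∈ Q.spaceA) : Q.proj₀ *ᵥ v = v := by
  induction hv using Submodule.span_induction with
  | mem v hv =>
    obtain ⟨x, -, rfl⟩ := hv
    ext i
    rw [Q.proj₀_mulVec_apply, ket₃]
    split_ifs <;> tauto
  | zero => simp only [Matrix.mulVec_zero]
  | add v w _ _ hv hw => simp only [Matrix.mulVec_add, hv, hw]
  | smul c v _ hv => simp only [Matrix.mulVec_smul, hv]

theorem spaceA_le_stateSpace : Q.spaceA ≤ Q.stateSpace := by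
  refine Submodule.span_le.mpr ?_
  rintro _ ⟨x, hx, rfl⟩
  exact Q.ket_mem_stateSpace hx 0 0

theorem eq_sum_ket_of_mem_spaceA {v : Q.Idx → ℂ} (hv : v ∈ Q.spaceA) :
    v = ∑ x : C.Ω, v (Q.stateIdx x) • ket₃ x 0 0 :=
  Q.eq_sum_ket (Q.spaceA_le_stateSpace hv) (Q.proj₀_mulVec_of_mem_spaceA hv)

end WalkCircuit

/-! ### Entries of the discriminant matrix -/

namespace MHChain

variable {d : ℕ} (C : MHChain d)

theorem sum_moves {M : Type*} [AddCommMonoid M] (x : Fin d → ℝ) (f : (Fin d → ℝ) → M) :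
    ∑ m ∈ C.moves x, f m = ∑ z ∈ C.Ω, f (z - x) :=
  Finset.sum_image fun _ _ _ _ h => sub_left_injective h

theorem sub_mem_moves {x y : Fin d → ℝ} (hy : y ∈ C.Ω) : y - x ∈ C.moves x :=
  Finset.mem_image_of_mem _ hy

/-- Detailed balance turns the geometric mean of the two opposite flows into a rescaling of one of
them. -/
theorem sqrt_mul_sqrt_eq (x y : C.Ω) :
    √(C.T y x * C.acc y x) * √(C.T x y * C.acc x y) =
      √(C.P y) / √(C.P x) * (C.T y x * C.acc y x) := by
  have hx := (C.P_mem x x.2).1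
  have hy := (C.P_mem y y.2).1
  have h := C.detailed_balance x.2 y.2
  have ha : 0 ≤ C.T y x * C.acc y x :=
    mul_nonneg (C.T_mem y y.2 x x.2).1.le (C.acc_pos y.2 x.2).le
  have hb : C.T x y * C.acc x y = C.P y / C.P x * (C.T y x * C.acc y x) := by
    field_simp
    linarith
  rw [hb, Real.sqrt_mul (div_pos hy hx).le (C.T y x * C.acc y x), Real.sqrt_div hy.le,
    mul_left_comm, Real.mul_self_sqrt ha]

theorem W_eq (x y : C.Ω) :
    C.W y x = (if y = x then ∑ z ∈ C.Ω, C.T x z * (1 - C.acc x z) else 0) +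
      C.T y x * C.acc y x := by
  by_cases h : y = x
  · subst h
    rw [if_pos rfl, W_self_eq]
  · rw [if_neg h, W_of_ne C h, zero_add]

/-- The two summands are the form in which the circuit produces the entry: rejection (qubit `0`) and
acceptance (qubit `1`). -/
theorem sqrt_div_sqrt_mul_W (x y : C.Ω) :
    √(C.P y) / √(C.P x) * C.W y x =
      (if y = x then ∑ z ∈ C.Ω, C.T x z * (1 - C.acc x z) else 0) +
        √(C.T y x * C.acc y x) * √(C.T x y * C.acc x y) := by
  rw [W_eq, mul_add, sqrt_mul_sqrt_eq]
  congr 1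
  split_ifs with h
  · rw [h, div_self (Real.sqrt_ne_zero'.mpr (C.P_mem x x.2).1), one_mul]
  · rw [mul_zero]

end MHChain

/-! ### Compression of the walk to `𝒜` and its eigenvectors -/

namespace WalkCircuit

variable {d : ℕ} {C : MHChain d} (Q : WalkCircuit C)

theorem star_ket_dotProduct {x m : Fin d → ℝ} (hx : x ∈ C.Ω) (hm : m ∈ C.moves x) (c : Fin 2)
    (v : Q.Idx → ℂ) : star (ket₃ x m c : Q.Idx → ℂ) ⬝ᵥ v =
      v (⟨x, Q.states_subset hx⟩, ⟨m, Q.moves_subset x hx hm⟩, c) := by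
  rw [dotProduct, Finset.sum_eq_single (⟨x, Q.states_subset hx⟩, ⟨m, Q.moves_subset x hx hm⟩, c)]
  · simp [ket₃]
  · intro i _ hi
    rw [Pi.star_apply, ket₃, if_neg, star_zero, zero_mul]
    rintro ⟨h1, h2, h3⟩
    exact hi (Prod.ext (Subtype.ext h1) (Prod.ext (Subtype.ext h2) h3))
  · simp

theorem star_ket_dotProduct_ket {x m : Fin d → ℝ} (hx : x ∈ C.Ω) (hm : m ∈ C.moves x)
    (c : Fin 2) (x' m' : Fin d → ℝ) (c' : Fin 2) :
    star (ket₃ x m c : Q.Idx → ℂ) ⬝ᵥ ket₃ x' m' c' =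
      if x = x' ∧ m = m' ∧ c = c' then 1 else 0 := by
  rw [Q.star_ket_dotProduct hx hm]
  rfl

theorem opB_opV_mulVec_ket {x : Fin d → ℝ} (hx : x ∈ C.Ω) :
    Q.opB *ᵥ (Q.opV *ᵥ ket₃ x 0 0) = ∑ z ∈ C.Ω, ((√(C.T x z) : ℝ) : ℂ) •
      (((√(1 - C.acc x z) : ℝ) : ℂ) • ket₃ x (z - x) 0 +
        ((√(C.acc x z) : ℝ) : ℂ) • ket₃ x (z - x) 1) := by
  rw [Q.opV_mulVec_ket hx, C.sum_moves, ← Matrix.mulVecLin_apply, map_sum]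
  refine Finset.sum_congr rfl fun z hz => ?_
  rw [map_smul, Matrix.mulVecLin_apply, opB, Q.B_apply_zero x hx _ (C.sub_mem_moves hz),
    add_sub_cancel]

theorem opS_opF_opB_opV_mulVec_ket {x : Fin d → ℝ} (hx : x ∈ C.Ω) :
    Q.opS *ᵥ (Q.opF *ᵥ (Q.opB *ᵥ (Q.opV *ᵥ ket₃ x 0 0))) =
      ∑ z ∈ C.Ω, ((√(C.T x z) : ℝ) : ℂ) • (((√(1 - C.acc x z) : ℝ) : ℂ) • ket₃ x (z - x) 0 +
        ((√(C.acc x z) : ℝ) : ℂ) • ket₃ z (x - z) 1) := by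
  rw [Q.opB_opV_mulVec_ket hx, ← Matrix.mulVecLin_apply, ← Matrix.mulVecLin_apply,
    map_sum, map_sum]
  refine Finset.sum_congr rfl fun z hz => ?_
  simp only [map_smul, map_add, Matrix.mulVecLin_apply,
    Q.opS_opF_mulVec_ket_zero hx (C.sub_mem_moves hz),
    Q.opS_opF_mulVec_ket_one hx (C.sub_mem_moves hz), add_sub_cancel, neg_sub]

/-- The compression of `V† B† S F B V` to `𝒜` is the discriminant matrix of the chain. -/
theorem core_mulVec_ket_apply (x y : C.Ω) :
    (Q.core *ᵥ ket₃ x 0 0) (Q.stateIdx y) =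
      ((√(C.P y) / √(C.P x) * C.W y x : ℝ) : ℂ) := by
  refine (Q.star_ket_dotProduct y.2 (zero_mem_moves y.2) 0 (Q.core *ᵥ ket₃ x 0 0)).symm.trans ?_
  -- Moving `V†` and `B†` to the left factor makes the entry the inner product of `BV|y⟩|0⟩|0⟩` with
  -- `SFBV|x⟩|0⟩|0⟩`.
  rw [core_mulVec, ← star_mulVec_dotProduct, ← star_mulVec_dotProduct,
    Q.opS_opF_opB_opV_mulVec_ket x.2, Q.opB_opV_mulVec_ket y.2, star_sum, sum_dotProduct]
  -- By orthonormality, the qubit-`0` terms meet only for the same state and the same rejected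
  -- proposal (`y = x`, `w = z`). The qubit-`1` terms meet only when the reversed move from `x` to
  -- `z` is the move from `y` to `w`, that is `z = y` and `w = x`.
  have hw (w : Fin d → ℝ) (hw : w ∈ C.Ω) (z : Fin d → ℝ) :
      star (((√(C.T y w) : ℝ) : ℂ) • (((√(1 - C.acc y w) : ℝ) : ℂ) • (ket₃ y (w - y) 0 : Q.Idx → ℂ)
        + ((√(C.acc y w) : ℝ) : ℂ) • (ket₃ y (w - y) 1 : Q.Idx → ℂ))) ⬝ᵥ
      (((√(C.T x z) : ℝ) : ℂ) • (((√(1 - C.acc x z) : ℝ) : ℂ) • (ket₃ x (z - x) 0 : Q.Idx → ℂ)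
        + ((√(C.acc x z) : ℝ) : ℂ) • (ket₃ z (x - z) 1 : Q.Idx → ℂ))) =
      (((if y = x then (if w = z then
          √(C.T y w) * √(C.T x z) * (√(1 - C.acc y w) * √(1 - C.acc x z)) else 0) else 0) +
        (if z = y then (if w = x then
          √(C.T y w) * √(C.T x z) * (√(C.acc y w) * √(C.acc x z)) else 0) else 0) : ℝ) : ℂ) := by
    have hm := C.sub_mem_moves (x := y) hw
    have e1 : ((y : Fin d → ℝ) = x ∧ w - y = z - x ∧ (0 : Fin 2) = 0) ↔ (y = x ∧ w = z) := by
      constructor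
      · rintro ⟨h, h', -⟩
        rw [h] at h'
        exact ⟨Subtype.ext h, sub_left_injective h'⟩
      · rintro ⟨rfl, rfl⟩
        exact ⟨rfl, rfl, rfl⟩
    have e2 : ((y : Fin d → ℝ) = z ∧ w - y = x - z ∧ (1 : Fin 2) = 1) ↔ (z = y ∧ w = x) := by
      constructor
      · rintro ⟨h, h', -⟩
        rw [h] at h'
        exact ⟨h.symm, sub_left_injective h'⟩
      · rintro ⟨rfl, rfl⟩
        exact ⟨rfl, rfl, rfl⟩
    have k0 : star (ket₃ y (w - y) 0 : Q.Idx → ℂ) ⬝ᵥ ket₃ x (z - x) 0 =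
        if y = x ∧ w = z then 1 else 0 :=
      (Q.star_ket_dotProduct_ket y.2 hm 0 x (z - x) 0).trans (if_congr e1 rfl rfl)
    have k1 : star (ket₃ y (w - y) 1 : Q.Idx → ℂ) ⬝ᵥ ket₃ z (x - z) 1 =
        if z = y ∧ w = x then 1 else 0 :=
      (Q.star_ket_dotProduct_ket y.2 hm 1 z (x - z) 1).trans (if_congr e2 rfl rfl)
    have k2 : star (ket₃ y (w - y) 0 : Q.Idx → ℂ) ⬝ᵥ ket₃ z (x - z) 1 = 0 :=
      (Q.star_ket_dotProduct_ket y.2 hm 0 z (x - z) 1).trans (by simp)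
    have k3 : star (ket₃ y (w - y) 1 : Q.Idx → ℂ) ⬝ᵥ ket₃ x (z - x) 0 = 0 :=
      (Q.star_ket_dotProduct_ket y.2 hm 1 x (z - x) 0).trans (by simp)
    simp only [star_smul, star_add, smul_dotProduct, dotProduct_smul, add_dotProduct,
      dotProduct_add, k0, k1, k2, k3, Complex.star_def, Complex.conj_ofReal, smul_eq_mul, mul_zero,
      zero_add, add_zero]
    rw [ite_and, ite_and]
    split_ifs <;> push_cast <;> ring
  rw [Finset.sum_congr rfl fun w hw' => by
    rw [dotProduct_sum, Finset.sum_congr rfl fun z _ => hw w hw' z]]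
  simp only [← Complex.ofReal_sum]
  congr 1
  rw [C.sqrt_div_sqrt_mul_W]
  simp only [Finset.sum_add_distrib]
  congr 1
  · by_cases h : y = x
    · subst h
      simp only [if_true]
      refine Finset.sum_congr rfl fun w hw' => ?_
      rw [Finset.sum_ite_eq, if_pos hw', Real.mul_self_sqrt (C.T_mem y y.2 w hw').1.le,
        Real.mul_self_sqrt (sub_nonneg.mpr (C.acc_le_one _ _))]
    · simp only [h, if_false, Finset.sum_const_zero]
  · rw [Finset.sum_comm]
    simp only [Finset.sum_ite_irrel, Finset.sum_const_zero, Finset.sum_ite_eq', x.2, y.2, if_true]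
    rw [Real.sqrt_mul (C.T_mem y y.2 x x.2).1.le, Real.sqrt_mul (C.T_mem x x.2 y y.2).1.le]
    ring

/-- The substitution `v = √P · f` removes the conjugation by `√P`, so the compression acts on `f` as
`W` acts on functions. Thus `|P⟩` corresponds to the constant `1`. -/
theorem core_mulVec_apply_stateIdx {v : Q.Idx → ℂ} (hv : v ∈ Q.spaceA) (y : C.Ω) :
    (Q.core *ᵥ v) (Q.stateIdx y) = (√(C.P y) : ℝ) *
      (C.W.map (algebraMap ℝ ℂ) *ᵥ fun x => v (Q.stateIdx x) / (√(C.P x) : ℝ)) y := by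
  nth_rw 1 [Q.eq_sum_ket_of_mem_spaceA hv]
  rw [← Matrix.mulVecLin_apply, map_sum, Finset.sum_apply, Matrix.mulVec, dotProduct,
    Finset.mul_sum]
  refine Finset.sum_congr rfl fun x _ => ?_
  rw [map_smul, Matrix.mulVecLin_apply, Pi.smul_apply, Q.core_mulVec_ket_apply]
  simp only [Matrix.map_apply, Complex.coe_algebraMap, smul_eq_mul]
  push_cast
  ring

theorem sqrt_P_ne_zero (x : C.Ω) : ((√(C.P x) : ℝ) : ℂ) ≠ 0 :=
  Complex.ofReal_ne_zero.mpr (Real.sqrt_ne_zero'.mpr (C.P_mem x x.2).1)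

/-- Eigenvectors in `𝒜` of the compression of `V† B† S F B V` are eigenvectors of `W` up to the
scaling by `√P`. -/
theorem W_mulVec_of_compression {v : Q.Idx → ℂ} (hv : v ∈ Q.spaceA) {z : ℂ}
    (h : Q.proj₀ *ᵥ (Q.core *ᵥ v) = z • v) :
    C.W.map (algebraMap ℝ ℂ) *ᵥ (fun x => v (Q.stateIdx x) / (√(C.P x) : ℝ)) =
      z • fun x => v (Q.stateIdx x) / (√(C.P x) : ℝ) := by
  ext y
  have hP := sqrt_P_ne_zero y
  have h1 := congrFun h (Q.stateIdx y)
  rw [Q.proj₀_mulVec_apply, if_pos ⟨rfl, rfl⟩, Q.core_mulVec_apply_stateIdx hv] at h1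
  rw [Pi.smul_apply, smul_eq_mul, ← mul_div_assoc, eq_div_iff hP, mul_comm, h1, Pi.smul_apply,
    smul_eq_mul]

theorem ketP_mem_spaceA : Q.ketP ∈ Q.spaceA :=
  Submodule.sum_mem _ fun _ hx => Submodule.smul_mem _ _ (Q.ket_mem_spaceA hx)

theorem ketP_apply_stateIdx (y : C.Ω) : Q.ketP (Q.stateIdx y) = (√(C.P y) : ℝ) := by
  rw [ketP, ← Finset.sum_coe_sort, Finset.sum_apply]
  simp only [Pi.smul_apply, Q.ket_apply_stateIdx, smul_eq_mul, mul_ite, mul_one, mul_zero,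
    Finset.sum_ite_eq', Finset.mem_univ, if_true]

theorem ext_spaceA {v w : Q.Idx → ℂ} (hv : v ∈ Q.spaceA) (hw : w ∈ Q.spaceA)
    (h : ∀ x, v (Q.stateIdx x) = w (Q.stateIdx x)) : v = w := by
  rw [Q.eq_sum_ket_of_mem_spaceA hv, Q.eq_sum_ket_of_mem_spaceA hw]
  simp only [h]

theorem ketP_ne_zero : Q.ketP ≠ 0 := by
  obtain ⟨x, hx⟩ := C.nonempty
  intro h
  have h1 := Q.ketP_apply_stateIdx ⟨x, hx⟩
  rw [h] at h1
  exact sqrt_P_ne_zero ⟨x, hx⟩ h1.symm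

theorem proj₀_core_mulVec_mem_spaceA {v : Q.Idx → ℂ} (hv : v ∈ Q.spaceA) :
    Q.proj₀ *ᵥ (Q.core *ᵥ v) ∈ Q.spaceA :=
  Q.proj₀_mulVec_mem_spaceA (Q.core_mulVec_mem_stateSpace hv)

theorem proj₀_core_mulVec_ketP : Q.proj₀ *ᵥ (Q.core *ᵥ Q.ketP) = Q.ketP := by
  refine Q.ext_spaceA (Q.proj₀_core_mulVec_mem_spaceA Q.ketP_mem_spaceA) Q.ketP_mem_spaceA ?_
  intro y
  rw [Q.proj₀_mulVec_apply, if_pos ⟨rfl, rfl⟩, Q.core_mulVec_apply_stateIdx Q.ketP_mem_spaceA]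
  have h : (fun x => Q.ketP (Q.stateIdx x) / ((√(C.P x) : ℝ) : ℂ)) = 1 := by
    ext x
    rw [Q.ketP_apply_stateIdx, div_self (sqrt_P_ne_zero x), Pi.one_apply]
  rw [h, C.W_mulVec_one, Pi.one_apply, mul_one, Q.ketP_apply_stateIdx]

theorem eq_smul_ketP_of_compression_fixed {v : Q.Idx → ℂ} (hv : v ∈ Q.spaceA)
    (h : Q.proj₀ *ᵥ (Q.core *ᵥ v) = v) : ∃ c : ℂ, v = c • Q.ketP := by
  have h1 := Q.W_mulVec_of_compression hv (z := 1) (by rw [h, one_smul])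
  rw [one_smul] at h1
  obtain ⟨x, hx⟩ := C.nonempty
  refine ⟨v (Q.stateIdx ⟨x, hx⟩) / (√(C.P x) : ℝ),
    Q.ext_spaceA hv (Submodule.smul_mem _ _ Q.ketP_mem_spaceA) fun y => ?_⟩
  rw [Pi.smul_apply, Q.ketP_apply_stateIdx, smul_eq_mul,
    ← C.complex_harmonic_const h1 y ⟨x, hx⟩, div_mul_cancel₀ _ (sqrt_P_ne_zero y)]

theorem norm_le_of_compression_eigenvector {v : Q.Idx → ℂ} (hv : v ∈ Q.spaceA) (hv0 : v ≠ 0)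
    {z : ℂ} (hz : ‖z‖ ≤ 1) (hz1 : z ≠ 1) (h : Q.proj₀ *ᵥ (Q.core *ᵥ v) = z • v) :
    ‖z‖ ≤ 1 - C.spectralGap := by
  refine C.norm_le_of_eigenvector hz hz1 (fun h0 => hv0 ?_) (Q.W_mulVec_of_compression hv h)
  refine Q.ext_spaceA hv (Submodule.zero_mem _) fun x => ?_
  have := congrFun h0 x
  exact (div_eq_zero_iff.mp this).resolve_right (sqrt_P_ne_zero x)

theorem arccos_le_abs_of_eigenvalue {v : Q.Idx → ℂ} (hv : v ∈ Q.spaceA ⊔ Q.spaceB)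
    (hv0 : v ≠ 0) {θ : ℝ} (hθ : Complex.exp (θ * Complex.I) ≠ 1)
    (h : Q.U *ᵥ v = Complex.exp (θ * Complex.I) • v) :
    Real.arccos (1 - C.spectralGap) ≤ |θ| := by
  have hexp := Complex.exp_mul_I (θ : ℂ)
  rw [← Complex.ofReal_cos, ← Complex.ofReal_sin] at hexp
  have hcs := Real.sin_sq_add_cos_sq θ
  -- The eigenvalue `-1` is separated because `v` need not be recoverable from its projection there;
  -- but then `cos θ = -1`, so `|θ| ≥ π`.
  by_cases h2 : Complex.exp (θ * Complex.I) ^ 2 = 1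
  · have h3 := (sq_eq_sq_iff_eq_or_eq_neg.mp (h2.trans (one_pow 2).symm)).resolve_left hθ
    have hcos : Real.cos θ = -1 := by
      rw [← Complex.exp_ofReal_mul_I_re, h3, Complex.neg_re, Complex.one_re]
    refine (Real.arccos_le_pi _).trans ?_
    rw [← Real.arccos_neg_one]
    exact Real.arccos_le_abs_of_cos_le hcos.le
  · obtain ⟨p, hp, hp0, hpe⟩ := exists_compression_eigenvector
      (fun _ => Q.proj₀_mulVec_of_mem_spaceA) Q.proj₀_mul_self
      (fun _ => Q.proj₀_core_mulVec_mem_spaceA) (fun _ => Q.core_mulVec_core_mulVec) h2 hv hv0 h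
    have hz0 : 2 * Complex.exp (θ * Complex.I) ≠ 0 :=
      mul_ne_zero two_ne_zero (Complex.exp_ne_zero _)
    -- This is `z + z⁻¹ = 2 cos θ` multiplied by `z`; it identifies the eigenvalue of the
    -- compression as `cos θ`.
    have hcos : 1 + Complex.exp (θ * Complex.I) ^ 2 =
        2 * Complex.exp (θ * Complex.I) * (Real.cos θ : ℂ) := by
      rw [hexp]
      have hcs' : (Real.sin θ : ℂ) ^ 2 + (Real.cos θ : ℂ) ^ 2 = 1 := by exact_mod_cast hcs
      linear_combination (Real.sin θ : ℂ) ^ 2 * Complex.I_sq - hcs'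
    rw [hcos, mul_smul _ (Real.cos θ : ℂ)] at hpe
    have hpe' := smul_right_injective _ hz0 hpe
    -- Needed so that `cos θ` is a root of the characteristic polynomial of `W` other than the root
    -- `1`.
    have hcos1 : Real.cos θ ≠ 1 := by
      intro hc
      have hs : Real.sin θ = 0 := by
        rw [hc] at hcs
        nlinarith
      apply hθ
      rw [hexp, hc, hs]
      simp
    have hle := Q.norm_le_of_compression_eigenvector hp hp0 (z := (Real.cos θ : ℂ))
      (by rw [Complex.norm_real]; exact Real.abs_cos_le_one θ) (by exact_mod_cast hcos1) hpe'
    rw [Complex.norm_real] at hle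
    exact Real.arccos_le_abs_of_cos_le ((le_abs_self _).trans hle)

theorem U_conjTranspose_mul_self : Q.Uᴴ * Q.U = 1 :=
  conjTranspose_mul_self_of_reflection Q.core_conjTranspose_mul_self Q.proj₀_conjTranspose
    Q.proj₀_mul_self

end WalkCircuit

/-- On `𝒜 + ℬ`, which `U` maps into itself, `|P⟩` spans the eigenspace of `U` for the eigenvalue
`1`, and any other eigenvalue is of the form `e^{iθ}` with real `θ`, where every such `θ` satisfies
`|θ| ≥ arccos (1 - Δ)`. -/
theorem mainTheorem3 {d : ℕ} (C : MHChain d) (Q : WalkCircuit C) :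
    (∀ v ∈ Q.spaceA ⊔ Q.spaceB, Q.U *ᵥ v ∈ Q.spaceA ⊔ Q.spaceB) ∧
    (Q.ketP ∈ Q.spaceA ⊔ Q.spaceB ∧ Q.ketP ≠ 0 ∧ Q.U *ᵥ Q.ketP = Q.ketP ∧
      ∀ v ∈ Q.spaceA ⊔ Q.spaceB, Q.U *ᵥ v = v → ∃ c : ℂ, v = c • Q.ketP) ∧
    (∀ z : ℂ, z ≠ 1 → (∃ v ∈ Q.spaceA ⊔ Q.spaceB, v ≠ 0 ∧ Q.U *ᵥ v = z • v) →
      (∃ θ : ℝ, z = Complex.exp (θ * Complex.I)) ∧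
      ∀ θ : ℝ, z = Complex.exp (θ * Complex.I) → Real.arccos (1 - C.spectralGap) ≤ |θ|) := by
  have hLA : ∀ a ∈ Q.spaceA, Q.proj₀ *ᵥ a = a := fun _ => Q.proj₀_mulVec_of_mem_spaceA
  have hLG : ∀ a ∈ Q.spaceA, Q.proj₀ *ᵥ (Q.core *ᵥ a) ∈ Q.spaceA :=
    fun _ => Q.proj₀_core_mulVec_mem_spaceA
  have hGG : ∀ a ∈ Q.spaceA, Q.core *ᵥ (Q.core *ᵥ a) = a := fun _ => Q.core_mulVec_core_mulVec
  refine ⟨fun v hv => reflection_mul_mulVec_mem_sup hLA hLG hGG hv,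
    ⟨Submodule.mem_sup_left Q.ketP_mem_spaceA, Q.ketP_ne_zero, ?_, fun v hv h => ?_⟩, ?_⟩
  · exact reflection_fixed_of_compression_fixed Q.core_conjTranspose_mul_self
      Q.proj₀_conjTranspose hLA Q.ketP_mem_spaceA Q.proj₀_core_mulVec_ketP
  · obtain ⟨h1, h2⟩ := mem_and_compression_fixed Q.core_conjTranspose_mul_self
      Q.proj₀_conjTranspose hLA Q.proj₀_mul_self hLG hGG hv h
    exact Q.eq_smul_ketP_of_compression_fixed h1 h2
  · rintro z hz ⟨v, hv, hv0, h⟩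
    refine ⟨?_, ?_⟩
    · obtain ⟨θ, hθ⟩ := (Complex.norm_eq_one_iff z).mp
        (norm_eq_one_of_mulVec_eq_smul Q.U_conjTranspose_mul_self hv0 h)
      exact ⟨θ, hθ.symm⟩
    · rintro θ rfl
      exact Q.arccos_le_abs_of_eigenvalue hv hv0 hz h
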